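/- Let $(X,d)$ be a proper geodesic Gromov hyperbolic metric space with Gromov boundary $\partial_G X$ and Gromov compactification $\overline X^G = X\sqcup\partial_G X$, and let $f\colon X\to X$ be a non-expanding map, i.e. $d(f(x),f(y))\le d(x,y)$ for all $x,y\in X$. For $\eta\in\partial_G X$ and $p\in X$ the dilation $\lambda_{\eta,p}(f)\in(0,+\infty]$ is defined by $\log\lambda_{\eta,p}(f)=\liminf_{z\to\eta}\big(d(z,p)-d(f(z),p)\big)$. The point $\eta$ is a boundary regular fixed point (BRFP) of $f$ if $\lambda_{\eta,p}(f)<+\infty$ for every $p\in X$ (equivalently, for one $p\in X$) and $f$ has geodesic limit $\eta$ at $\eta$, i.e. $f(z_n)\to\eta$ for every sequence $(z_n)$ in $X$ that converges to $\eta$ and is contained in some region $\{z\in X: d(z,\gamma)<R\}$, where $R>0$ and $\gamma$ is a geodesic ray with endpoint $\eta$. The stable dilation $\Lambda_\eta$ of $f$ at a BRFP $\eta$ is defined by $\log\Lambda_\eta=\lim_{n\to\infty}\frac1n\log\lambda_{\eta,p}(f^n)$, where $p\in X$ is arbitrary. A backward orbit of $f$ is a sequence $(x_n)_{n\ge0}$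 in $X$ with $f(x_{n+1})=x_n$ for all $n\ge 0$; it has bounded step if $\sup_n d(x_n,x_{n+1})<+\infty$. In this case let $\sigma_m(x_n)=\lim_{n\to\infty}d(x_{n+m},x_n)$ for $m\ge1$, and define the backward step rate $b(x_n)=\lim_{m\to\infty}\sigma_m(x_n)/m$. Let $(x_n)$ be a backward orbit of $f$ with bounded step and let $\eta\in\partial_G X$ be a limit point of $(x_n)$, i.e. the limit in $\overline X^G$ of some subsequence of $(x_n)$. Then $\eta$ is a BRFP of $f$; the limits defining $\log\Lambda_\eta$ (which is independent of $p$), $\sigma_m(x_n)$ ($m\ge 1$) and $b(x_n)$ exist and are finite; and $$0\le\log\Lambda_\eta\le b(x_n).$$ -/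

import Mathlib

open Filter Topology
open scoped NNReal

namespace GromovDynamics

section Geometry

/-- `S` is (the image of) a geodesic segment joining `x` to `y`. -/
def IsGeodesicSegment {X : Type*} [MetricSpace X] (x y : X) (S : Set X) : Prop :=
  ∃ γ : ℝ → X, γ 0 = x ∧ γ (dist x y) = y ∧
    (∀ s ∈ Set.Icc 0 (dist x y), ∀ t ∈ Set.Icc 0 (dist x y), dist (γ s) (γ t) = |s - t|) ∧
    S = γ '' Set.Icc 0 (dist x y)

/-- `X` is a geodesic metric space: any two points are joined by a geodesic segment. -/
def IsGeodesicSpace (X : Type*) [MetricSpace X] : Prop :=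
  ∀ x y : X, ∃ S : Set X, IsGeodesicSegment x y S

/-- Every geodesic triangle is `δ`-slim: each side is contained in the `δ`-neighbourhood of the
union of the other two. (Cyclic permutations of `x, y, z` give the statement for all sides.) -/
def IsDeltaHyperbolic (X : Type*) [MetricSpace X] (δ : ℝ) : Prop :=
  ∀ (x y z : X) (S₁ S₂ S₃ : Set X), IsGeodesicSegment x y S₁ → IsGeodesicSegment y z S₂ →
    IsGeodesicSegment z x S₃ → S₁ ⊆ Metric.thickening δ (S₂ ∪ S₃)

/-- `X` is Gromov hyperbolic: it is `δ`-hyperbolic for some `δ > 0`. -/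
def IsGromovHyperbolic (X : Type*) [MetricSpace X] : Prop :=
  ∃ δ : ℝ, 0 < δ ∧ IsDeltaHyperbolic X δ

/-- A geodesic ray: an isometric embedding of `[0, ∞)` into `X`. -/
structure GeodesicRay (X : Type*) [MetricSpace X] where
  toFun : ℝ≥0 → X
  isometry : Isometry toFun

/-- Two rays are asymptotic if they stay at bounded distance from each other. -/
def GeodesicRay.Asymptotic {X : Type*} [MetricSpace X] (γ σ : GeodesicRay X) : Prop :=
  ∃ K : ℝ, ∀ t : ℝ≥0, dist (γ.toFun t) (σ.toFun t) ≤ K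

theorem GeodesicRay.asymptotic_equivalence (X : Type*) [MetricSpace X] :
    Equivalence (GeodesicRay.Asymptotic (X := X)) where
  refl γ := ⟨0, fun t => by simp⟩
  symm := fun ⟨K, h⟩ => ⟨K, fun t => by rw [dist_comm]; exact h t⟩
  trans := fun ⟨K, h⟩ ⟨L, k⟩ =>
    ⟨K + L, fun t => (dist_triangle _ _ _).trans (add_le_add (h t) (k t))⟩

/-- The setoid of geodesic rays up to asymptoticity. -/
def GeodesicRay.setoid (X : Type*) [MetricSpace X] : Setoid (GeodesicRay X) :=
  ⟨GeodesicRay.Asymptotic, GeodesicRay.asymptotic_equivalence X⟩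

/-- The Gromov boundary: geodesic rays up to asymptoticity. -/
def GromovBoundary (X : Type*) [MetricSpace X] : Type _ :=
  Quotient (GeodesicRay.setoid X)

/-- The endpoint at infinity of a geodesic ray. -/
def GeodesicRay.endpoint {X : Type*} [MetricSpace X] (γ : GeodesicRay X) : GromovBoundary X :=
  Quotient.mk (GeodesicRay.setoid X) γ

/-- The Gromov compactification as a set: the disjoint union of `X` and its Gromov boundary. -/
inductive GromovCompactification (X : Type*) [MetricSpace X] where
  | ofPoint : X → GromovCompactification X
  | ofBoundary : GromovBoundary X → GromovCompactification X

open GromovCompactification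

/-- The Gromov product of `x` and `y` with respect to `w`. -/
noncomputable def gromovProduct {X : Type*} [MetricSpace X] (w x y : X) : ℝ :=
  (dist x w + dist y w - dist x y) / 2

/-- The points of the compactification whose Gromov product with `η` (based at `p`) is at
least `r`. -/
def boundaryNhd {X : Type*} [MetricSpace X] (p : X) (η : GromovBoundary X) (r : ℝ) :
    Set (GromovCompactification X) :=
  {y | match y with
    | ofPoint x => ∀ γ : GeodesicRay X, γ.endpoint = η →
        ∀ᶠ t in atTop, r ≤ gromovProduct p x (γ.toFun t)
    | ofBoundary ξ => ∀ γ σ : GeodesicRay X, γ.endpoint = η → σ.endpoint = ξ →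
        ∀ᶠ q : ℝ≥0 × ℝ≥0 in atTop, r ≤ gromovProduct p (σ.toFun q.1) (γ.toFun q.2)}

/-- The system of neighbourhoods defining the topology of the Gromov compactification: metric
neighbourhoods at points of `X`, and sets of points with large Gromov product with `η` at
a boundary point `η`. -/
def gromovNhds {X : Type*} [MetricSpace X] :
    GromovCompactification X → Filter (GromovCompactification X)
  | ofPoint x => map ofPoint (𝓝 x)
  | ofBoundary η => ⨅ (p : X) (r : ℝ), 𝓟 (boundaryNhd p η r)

/-- The topology of the Gromov compactification. -/
instance {X : Type*} [MetricSpace X] : TopologicalSpace (GromovCompactification X) :=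
  TopologicalSpace.mkOfNhds gromovNhds

theorem fourPoint {X : Type*} [MetricSpace X] {δ : ℝ} (hg : IsGeodesicSpace X)
    (hδ : IsDeltaHyperbolic X δ) (w x y z : X) :
    min (gromovProduct w x z) (gromovProduct w z y) - 3 * δ ≤ gromovProduct w x y := by
  have symm : ∀ {a b : X} {S : Set X}, IsGeodesicSegment a b S → IsGeodesicSegment b a S := by
    rintro a b S ⟨γ, h0, h1, hi, rfl⟩
    refine ⟨fun t => γ (dist a b - t), by simpa using h1, by simpa [dist_comm b a] using h0, ?_, ?_⟩
    · intro s hs t ht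
      rw [dist_comm b a] at hs ht
      rw [hi _ ⟨by linarith [hs.2], by linarith [hs.1]⟩ _ ⟨by linarith [ht.2], by linarith [ht.1]⟩,
        abs_sub_comm]
      congr 1; ring
    · rw [dist_comm b a]
      ext u; constructor
      · rintro ⟨t, ht, rfl⟩
        exact ⟨dist a b - t, ⟨by linarith [ht.2], by linarith [ht.1]⟩, by simp⟩
      · rintro ⟨t, ht, rfl⟩
        exact ⟨dist a b - t, ⟨by linarith [ht.2], by linarith [ht.1]⟩, rfl⟩
  have add : ∀ {a b : X} {S : Set X}, IsGeodesicSegment a b S → ∀ u ∈ S,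
      dist a u + dist u b = dist a b := by
    rintro a b S ⟨γ, h0, h1, hi, rfl⟩ _ ⟨t, ht, rfl⟩
    have e1 := hi 0 ⟨le_rfl, dist_nonneg⟩ t ht
    have e2 := hi t ht (dist a b) ⟨dist_nonneg, le_rfl⟩
    rw [h0, abs_sub_comm, abs_of_nonneg (by linarith [ht.1])] at e1
    rw [h1, abs_sub_comm, abs_of_nonneg (by linarith [ht.2])] at e2
    linarith
  have ends : ∀ {a b : X} {S : Set X}, IsGeodesicSegment a b S → a ∈ S ∧ b ∈ S := by
    rintro a b S ⟨γ, h0, h1, hi, rfl⟩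
    exact ⟨⟨0, ⟨le_rfl, dist_nonneg⟩, h0⟩, ⟨_, ⟨dist_nonneg, le_rfl⟩, h1⟩⟩
  have conn : ∀ {a b : X} {S : Set X}, IsGeodesicSegment a b S → IsPreconnected S := by
    rintro a b S ⟨γ, h0, h1, hi, rfl⟩
    refine isPreconnected_Icc.image _ ?_
    have : LipschitzOnWith 1 γ (Set.Icc 0 (dist a b)) :=
      LipschitzOnWith.of_dist_le_mul fun s hs t ht => by
        simp [hi s hs t ht, Real.dist_eq]
    exact this.continuousOn
  obtain ⟨S, hS⟩ := hg x y
  obtain ⟨A, hA⟩ := hg y w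
  obtain ⟨B, hB⟩ := hg w x
  obtain ⟨C, hC⟩ := hg y z
  obtain ⟨D, hD⟩ := hg z x
  have hδ0 : 0 < δ := by
    have := hδ x y z S C D hS hC hD (ends hS).1
    obtain ⟨v, -, hv⟩ := Metric.mem_thickening_iff.1 this
    exact dist_nonneg.trans_lt hv
  have cov := hδ x y w S A B hS hA hB
  rw [Metric.thickening_union] at cov
  obtain ⟨u, huS, huA, huB⟩ := conn hS _ _ Metric.isOpen_thickening Metric.isOpen_thickening cov
    ⟨y, (ends hS).2, Metric.self_subset_thickening hδ0 _ (ends hA).1⟩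
    ⟨x, (ends hS).1, Metric.self_subset_thickening hδ0 _ (ends hB).2⟩
  obtain ⟨a, haA, ha⟩ := Metric.mem_thickening_iff.1 huA
  obtain ⟨b, hbB, hb⟩ := Metric.mem_thickening_iff.1 huB
  have key : dist w u ≤ gromovProduct w x y + 2 * δ := by
    have h1 := add hA a haA
    have h2 := add hB b hbB
    have h3 := add hS u huS
    have := dist_triangle w a u
    have := dist_triangle w b u
    have := dist_triangle y a u
    have := dist_triangle u b x
    unfold gromovProduct
    simp only [dist_comm] at *
    linarith
  have low : ∀ {c d : X} {S : Set X}, IsGeodesicSegment c d S → ∀ v ∈ S,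
      gromovProduct w c d ≤ dist w v := by
    intro c d S hS v hv
    have := add hS v hv
    have h1 := dist_triangle c v w
    have h2 := dist_triangle d v w
    unfold gromovProduct
    rw [dist_comm w v]
    rw [dist_comm v d] at this
    linarith
  obtain ⟨v, hv, huv⟩ := Metric.mem_thickening_iff.1 (hδ x y z S C D hS hC hD huS)
  have hwv := dist_triangle w u v
  rcases hv with hv | hv
  · have := low (symm hC) v hv
    have := min_le_right (gromovProduct w x z) (gromovProduct w z y)
    linarith
  · have := low (symm hD) v hv
    have := min_le_left (gromovProduct w x z) (gromovProduct w z y)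
    linarith

theorem gromovProduct_comm {X : Type*} [MetricSpace X] (w x y : X) :
    gromovProduct w x y = gromovProduct w y x := by
  simp only [gromovProduct, dist_comm x y]; ring

theorem boundaryNhd_base {X : Type*} [MetricSpace X] (p q : X) (η : GromovBoundary X) (r : ℝ) :
    boundaryNhd p η (r + dist p q) ⊆ boundaryNhd q η r := by
  have key : ∀ a b : X, r + dist p q ≤ gromovProduct p a b → r ≤ gromovProduct q a b := by
    intro a b h
    have h1 := dist_triangle a q p
    have h2 := dist_triangle b q p
    unfold gromovProduct at *
    rw [dist_comm q p] at h1 h2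
    linarith
  rintro (x | ξ) h
  · exact fun γ hγ => (h γ hγ).mono fun t => key _ _
  · exact fun γ σ hγ hσ => (h γ σ hγ hσ).mono fun t => key _ _

theorem boundaryNhd_anti {X : Type*} [MetricSpace X] (p : X) (η : GromovBoundary X) {r s : ℝ}
    (hrs : r ≤ s) : boundaryNhd p η s ⊆ boundaryNhd p η r := by
  rintro (x | ξ) h
  · exact fun γ hγ => (h γ hγ).mono fun t => hrs.trans
  · exact fun γ σ hγ hσ => (h γ σ hγ hσ).mono fun t => hrs.trans

theorem mem_boundaryNhd_self {X : Type*} [MetricSpace X] (p : X) (η : GromovBoundary X) (r : ℝ) :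
    ofBoundary η ∈ boundaryNhd p η r := by
  intro γ σ hγ hσ
  obtain ⟨K, hK⟩ : σ.Asymptotic γ :=
    Quotient.exact (s := GeodesicRay.setoid X) (hσ.trans hγ.symm)
  obtain ⟨T, hT⟩ : ∃ T : ℝ≥0, r + K + dist p (σ.toFun 0) + dist p (γ.toFun 0) ≤ T :=
    ⟨Real.toNNReal _, Real.le_coe_toNNReal _⟩
  have hK0 : 0 ≤ K := dist_nonneg.trans (hK 0)
  filter_upwards [eventually_ge_atTop (T, T)] with ⟨s, t⟩ ⟨hs, ht⟩
  have hs' : (T : ℝ) ≤ s := hs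
  have ht' : (T : ℝ) ≤ t := ht
  have e1 := σ.isometry.dist_eq s 0
  have e2 := γ.isometry.dist_eq t 0
  have e3 := γ.isometry.dist_eq s t
  rw [NNReal.dist_eq] at e1 e2 e3
  simp only [NNReal.coe_zero, sub_zero, NNReal.abs_eq] at e1 e2
  have h1 := dist_triangle (σ.toFun s) p (σ.toFun 0)
  have h2 := dist_triangle (γ.toFun t) p (γ.toFun 0)
  have h3 := dist_triangle (σ.toFun s) (γ.toFun s) (γ.toFun t)
  have h4 := hK s
  have h5 : (0 : ℝ) ≤ dist p (σ.toFun 0) := dist_nonneg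
  have h6 : (0 : ℝ) ≤ dist p (γ.toFun 0) := dist_nonneg
  simp only [gromovProduct]
  rcases abs_cases ((s : ℝ) - t) with ⟨h, -⟩ | ⟨h, -⟩ <;> linarith

theorem hasBasis_gromovNhds {X : Type*} [MetricSpace X] (p : X) (η : GromovBoundary X) :
    (gromovNhds (ofBoundary η)).HasBasis (fun _ : ℝ => True) (boundaryNhd p η) := by
  have h : gromovNhds (ofBoundary η) = ⨅ r : ℝ, 𝓟 (boundaryNhd p η r) := by
    refine le_antisymm (iInf_le _ p) (le_iInf fun q => le_iInf fun r => ?_)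
    exact (iInf_le _ (r + dist p q)).trans (principal_mono.2 (boundaryNhd_base p q η r))
  rw [h]
  refine hasBasis_iInf_principal fun r s => ⟨max r s, ?_, ?_⟩
  · exact boundaryNhd_anti p η (le_max_left _ _)
  · exact boundaryNhd_anti p η (le_max_right _ _)

/-- On a Gromov hyperbolic geodesic space the prescribed neighbourhoods are the neighbourhoods of
the topology. -/
theorem nhds_eq_gromovNhds {X : Type*} [MetricSpace X] (hg : IsGeodesicSpace X)
    (hX : IsGromovHyperbolic X) (y : GromovCompactification X) : 𝓝 y = gromovNhds y := by
  obtain ⟨δ, hδ0, hδ⟩ := hX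
  refine TopologicalSpace.nhds_mkOfNhds gromovNhds y ?_ ?_
  · rintro (x | η)
    · intro s hs
      have hs' : ofPoint ⁻¹' s ∈ 𝓝 x := hs
      exact (mem_of_mem_nhds hs' : x ∈ ofPoint ⁻¹' s)
    · exact le_iInf fun p => le_iInf fun r => by
        simpa using mem_boundaryNhd_self p η r
  · rintro (x | η) s hs
    · have hs' : ofPoint ⁻¹' s ∈ 𝓝 x := hs
      exact eventually_map.2 (eventually_mem_nhds_iff.2 hs')
    · obtain ⟨γ₀, rfl⟩ := Quotient.exists_rep (s := GeodesicRay.setoid X) η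
      set η := Quotient.mk (GeodesicRay.setoid X) γ₀
      let p := γ₀.toFun 0
      obtain ⟨r, -, hr⟩ := (hasBasis_gromovNhds p η).mem_iff.1 hs
      refine (hasBasis_gromovNhds p η).eventually_iff.2 ⟨max (r + 1) (r + 3 * δ), trivial, ?_⟩
      rintro (x | ξ) h
      · replace h := boundaryNhd_anti p η (le_max_left _ _) h
        refine mem_of_superset (image_mem_map (Metric.ball_mem_nhds x one_pos)) ?_
        rintro _ ⟨x', hx', rfl⟩
        refine hr fun γ hγ => (h γ hγ).mono fun t ht => ?_
        have h1 := dist_triangle x x' p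
        have h2 := dist_triangle x' x (γ.toFun t)
        rw [Metric.mem_ball] at hx'
        unfold gromovProduct at *
        rw [dist_comm x x'] at h1
        linarith
      · replace h := boundaryNhd_anti p η (le_max_right _ _) h
        refine (hasBasis_gromovNhds p ξ).mem_iff.2 ⟨r + 3 * δ, trivial, fun z hz => hr ?_⟩
        obtain ⟨σ, hσ⟩ := Quotient.exists_rep (s := GeodesicRay.setoid X) ξ
        rcases z with x | ζ
        · intro γ hγ
          obtain ⟨a, ha⟩ := eventually_atTop.1 (hz σ hσ)
          obtain ⟨⟨b, c⟩, hb⟩ := eventually_atTop.1 (h γ σ hγ hσ)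
          filter_upwards [eventually_ge_atTop c] with t ht
          have h1 := ha (max a b) (le_max_left _ _)
          have h2 := hb (max a b, t) ⟨le_max_right _ _, ht⟩
          have h3 := fourPoint hg hδ p x (γ.toFun t) (σ.toFun (max a b))
          have := le_min h1 h2
          linarith
        · intro γ τ hγ hτ
          obtain ⟨⟨d, a⟩, ha⟩ := eventually_atTop.1 (hz σ τ hσ hτ)
          obtain ⟨⟨b, c⟩, hb⟩ := eventually_atTop.1 (h γ σ hγ hσ)
          filter_upwards [eventually_ge_atTop (d, c)] with ⟨u, t⟩ ⟨hu, ht⟩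
          have h1 := ha (u, max a b) ⟨hu, le_max_left _ _⟩
          have h2 := hb (max a b, t) ⟨le_max_right _ _, ht⟩
          have h3 := fourPoint hg hδ p (τ.toFun u) (γ.toFun t) (σ.toFun (max a b))
          have := le_min h1 h2
          simp only at *
          linarith

end Geometry

section Dynamics

open GromovCompactification

/-- The filter on `X` describing `z → η` in the Gromov compactification, with `z ∈ X`. -/
def approach {X : Type*} [MetricSpace X] (η : GromovBoundary X) : Filter X :=
  comap ofPoint (𝓝 (ofBoundary η))

/-- The geodesic region `A(γ, R)`: the open `R`-neighbourhood of the ray `γ`. -/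
def geodesicRegion {X : Type*} [MetricSpace X] (γ : GeodesicRay X) (R : ℝ) : Set X :=
  Metric.thickening R (Set.range γ.toFun)

/-- `g : X → Y` has geodesic limit `ξ` at `η`. -/
def HasGeodesicLimit {X Y : Type*} [MetricSpace X] [TopologicalSpace Y] (g : X → Y)
    (η : GromovBoundary X) (ξ : Y) : Prop :=
  ∀ u : ℕ → X, Tendsto (fun n => ofPoint (u n)) atTop (𝓝 (ofBoundary η)) →
    (∃ (γ : GeodesicRay X) (R : ℝ), γ.endpoint = η ∧ 0 < R ∧ ∀ n, u n ∈ geodesicRegion γ R) →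
    Tendsto (fun n => g (u n)) atTop (𝓝 ξ)

/-- The logarithm `log λ_{η,p}(f) = liminf_{z → η} (d(z, p) - d(f(z), p))` of the dilation of `f`
at `η` with respect to the base point `p`, as an extended real number. -/
noncomputable def logDilation {X : Type*} [MetricSpace X] (f : X → X) (η : GromovBoundary X)
    (p : X) : EReal :=
  liminf (fun z => ((dist z p - dist (f z) p : ℝ) : EReal)) (approach η)

/-- `η` is a boundary regular fixed point of `f`: its dilation is finite (with respect to one, or
equivalently every, base point) and `f` has geodesic limit `η` at `η`. -/
def IsBRFP {X : Type*} [MetricSpace X] (f : X → X) (η : GromovBoundary X) : Prop :=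
  (∀ p : X, logDilation f η p < ⊤) ∧ HasGeodesicLimit (fun z => ofPoint (f z)) η (ofBoundary η)

/-- The limit `lim_{n → ∞} log λ_{η,p}(f^n) / n` defining the logarithm of the stable dilation
`Λ_η` exists and equals the real number `L`, for every base point `p`. -/
def HasLogStableDilation {X : Type*} [MetricSpace X] (f : X → X) (η : GromovBoundary X)
    (L : ℝ) : Prop :=
  ∀ p : X, Tendsto (fun n : ℕ => logDilation (f^[n]) η p / (n : EReal)) atTop (𝓝 (L : EReal))

/-- `x` is a backward orbit of `f`. -/
def IsBackwardOrbit {X : Type*} (f : X → X) (x : ℕ → X) : Prop :=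
  ∀ n, f (x (n + 1)) = x n

/-- The sequence `x` has bounded step. -/
def HasBoundedStep {X : Type*} [MetricSpace X] (x : ℕ → X) : Prop :=
  ∃ K : ℝ, ∀ n, dist (x (n + 1)) (x n) ≤ K

/-- The limits `σ_m = lim_{n → ∞} d(x_{n+m}, x_n)`, `m ≥ 1`, and `b = lim_{m → ∞} σ_m / m` exist
(as real numbers); `b` is the backward step rate of `x`. -/
def HasBackwardStepRate {X : Type*} [MetricSpace X] (x : ℕ → X) (b : ℝ) : Prop :=
  ∃ σ : ℕ → ℝ, (∀ m, 1 ≤ m → Tendsto (fun n => dist (x (n + m)) (x n)) atTop (𝓝 (σ m))) ∧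
    Tendsto (fun m : ℕ => σ m / m) atTop (𝓝 b)

/-- The boundary point `η` is a limit point of the sequence `x`: some subsequence of `x` converges
to `η` in the Gromov compactification. -/
def IsBoundaryLimitPoint {X : Type*} [MetricSpace X] (x : ℕ → X) (η : GromovBoundary X) : Prop :=
  ∃ φ : ℕ → ℕ, StrictMono φ ∧ Tendsto (fun k => ofPoint (x (φ k))) atTop (𝓝 (ofBoundary η))

end Dynamics

end GromovDynamics

/-!
Let `γ` be a ray ending at `η`, with Busemann function `β`. In a hyperbolic space `β z` agrees up
to a constant with `d(z, w) - d(w, γ 0)` as soon as `w` is close to `η`. Comparing these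
differences at `w` and at `g w` gives Julia's lemma: if a non-expanding `g` moves points `w → η` to
points `g w → η` with `d(w, γ 0) - d(g w, γ 0) ≤ A`, then `β ∘ g ≤ β + A + O(δ)` on all of `X`.
Therefore `log λ_η(g)` differs by a bounded amount, independent of `g`, from
`D g = sup_z (β (g z) - β z)`. Since `n ↦ D (f^n)` is exactly subadditive, Fekete's lemma produces
`log Λ_η = lim D (f^n) / n`.

Along a backward orbit accumulating at `η`, `f^m` moves the points `x (n + m)` by at most `σ_m`,
so Julia's lemma gives `D (f^m) ≤ σ_m + O(δ)`, whence `log Λ_η ≤ b`. If `log Λ_η` were negative,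
then `β` would increase by at least a prescribed amount every `N` steps of the backward orbit;
hyperbolicity would make the orbit follow a path leading away from `η`, with bounded Gromov product
with `η`.
-/

namespace GromovDynamics

open GromovCompactification

section FourPoint

variable {X : Type*} [MetricSpace X] {δ : ℝ}

/-- Gromov's four-point form of `δ`-hyperbolicity, required at every base point. It makes sense
without geodesics and, unlike the slim triangle condition, passes directly to limits at infinity. -/
def IsFourPointHyperbolic (X : Type*) [MetricSpace X] (δ : ℝ) : Prop :=
  ∀ w x y z : X, min (gromovProduct w x z) (gromovProduct w z y) - δ ≤ gromovProduct w x y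

theorem IsDeltaHyperbolic.isFourPointHyperbolic (hδ : IsDeltaHyperbolic X δ)
    (hgeo : IsGeodesicSpace X) : IsFourPointHyperbolic X (3 * δ) :=
  fourPoint hgeo hδ

theorem IsFourPointHyperbolic.nonneg [Nonempty X] (hX : IsFourPointHyperbolic X δ) : 0 ≤ δ := by
  obtain ⟨p⟩ := ‹Nonempty X›
  simpa [gromovProduct] using hX p p p p

theorem IsFourPointHyperbolic.dist_add_dist_le (hX : IsFourPointHyperbolic X δ) (a b c d : X) :
    dist a b + dist c d ≤ max (dist a c + dist b d) (dist b c + dist a d) + 2 * δ := by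
  have h := hX d a b c
  unfold gromovProduct at h
  rw [dist_comm c b] at h
  rw [← sub_le_iff_le_add, le_max_iff]
  rcases min_le_iff.1 (sub_le_iff_le_add.1 h) with h | h
  · left; linarith
  · right; linarith

end FourPoint

namespace GeodesicRay

variable {X : Type*} [MetricSpace X] {δ : ℝ}

theorem exists_endpoint_eq (η : GromovBoundary X) : ∃ γ : GeodesicRay X, γ.endpoint = η :=
  Quotient.exists_rep η

theorem asymptotic_of_endpoint_eq {γ σ : GeodesicRay X} (h : γ.endpoint = σ.endpoint) :
    γ.Asymptotic σ :=
  Quotient.exact (s := setoid X) h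

variable (γ : GeodesicRay X)

theorem dist_apply (s t : ℝ≥0) : dist (γ.toFun s) (γ.toFun t) = |(s : ℝ) - t| := by
  rw [γ.isometry.dist_eq, NNReal.dist_eq]

theorem dist_apply_zero (t : ℝ≥0) : dist (γ.toFun t) (γ.toFun 0) = t := by
  simp [γ.dist_apply]

theorem dist_apply_of_le {s t : ℝ≥0} (hst : s ≤ t) :
    dist (γ.toFun s) (γ.toFun t) = t - s := by
  rw [γ.dist_apply, abs_sub_comm, abs_of_nonneg (sub_nonneg.2 (NNReal.coe_le_coe.2 hst))]

/-- The Busemann function of `γ`, normalized to vanish at `γ 0` and to tend to `-∞` along `γ`. The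
limit as `s → ∞` is encoded as an infimum because `s ↦ dist z (γ s) - s` is antitone and bounded
below. -/
noncomputable def busemann (z : X) : ℝ :=
  ⨅ s : ℝ≥0, (dist z (γ.toFun s) - s)

theorem neg_dist_le_dist_sub (z : X) (s : ℝ≥0) :
    -dist z (γ.toFun 0) ≤ dist z (γ.toFun s) - s := by
  have := dist_triangle_left (γ.toFun s) (γ.toFun 0) z
  rw [γ.dist_apply_zero] at this
  linarith

theorem antitone_dist_sub (z : X) : Antitone fun s : ℝ≥0 => dist z (γ.toFun s) - s := by
  intro s t hst
  have := dist_triangle z (γ.toFun s) (γ.toFun t)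
  rw [γ.dist_apply_of_le hst] at this
  linarith

theorem tendsto_busemann (z : X) :
    Tendsto (fun s : ℝ≥0 => dist z (γ.toFun s) - s) atTop (𝓝 (γ.busemann z)) :=
  tendsto_atTop_ciInf (γ.antitone_dist_sub z)
    ⟨-dist z (γ.toFun 0), Set.forall_mem_range.2 (γ.neg_dist_le_dist_sub z)⟩

theorem neg_dist_le_busemann (z : X) : -dist z (γ.toFun 0) ≤ γ.busemann z :=
  le_ciInf (γ.neg_dist_le_dist_sub z)

theorem busemann_le_add_dist (z w : X) : γ.busemann z ≤ γ.busemann w + dist z w := by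
  refine le_of_tendsto_of_tendsto' (γ.tendsto_busemann z)
    ((γ.tendsto_busemann w).add_const (dist z w)) fun s => ?_
  have := dist_triangle z w (γ.toFun s)
  linarith

theorem busemann_apply (t : ℝ≥0) : γ.busemann (γ.toFun t) = -t := by
  refine tendsto_nhds_unique (γ.tendsto_busemann _) (tendsto_const_nhds.congr' ?_)
  filter_upwards [eventually_ge_atTop t] with s hts
  rw [γ.dist_apply_of_le hts]
  ring

theorem busemann_apply_zero : γ.busemann (γ.toFun 0) = 0 := by
  simp [γ.busemann_apply]

theorem dist_add_busemann_le (hX : IsFourPointHyperbolic X δ) (a b c : X) :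
    dist a b + γ.busemann c ≤
      max (dist a c + γ.busemann b) (dist b c + γ.busemann a) + 2 * δ := by
  refine le_of_tendsto_of_tendsto' ((γ.tendsto_busemann c).const_add (dist a b))
    ((((γ.tendsto_busemann b).const_add (dist a c)).max
      ((γ.tendsto_busemann a).const_add (dist b c))).add_const (2 * δ)) fun s => ?_
  have h := hX.dist_add_dist_le a b c (γ.toFun s)
  rw [← sub_le_iff_le_add, le_max_iff] at h ⊢
  rcases h with h | h
  · left; linarith
  · right; linarith

/-- The Gromov product of `z` with the endpoint of `γ`, based at `γ 0`, expressed through the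
Busemann function. -/
noncomputable def endpointProduct (z : X) : ℝ :=
  (dist z (γ.toFun 0) - γ.busemann z) / 2

theorem tendsto_gromovProduct (z : X) :
    Tendsto (fun s : ℝ≥0 => gromovProduct (γ.toFun 0) z (γ.toFun s)) atTop
      (𝓝 (γ.endpointProduct z)) := by
  refine (((γ.tendsto_busemann z).const_sub (dist z (γ.toFun 0))).div_const 2).congr fun s => ?_
  rw [gromovProduct, γ.dist_apply_zero]
  ring

theorem endpointProduct_apply (t : ℝ≥0) : γ.endpointProduct (γ.toFun t) = t := by
  rw [endpointProduct, γ.dist_apply_zero, γ.busemann_apply]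
  ring

theorem endpointProduct_le_add_dist (z w : X) :
    γ.endpointProduct z ≤ γ.endpointProduct w + dist z w := by
  have hdist := dist_triangle z w (γ.toFun 0)
  have hbus := γ.busemann_le_add_dist w z
  rw [dist_comm w z] at hbus
  unfold endpointProduct
  linarith

theorem abs_dist_sub_dist_sub_busemann_le (hX : IsFourPointHyperbolic X δ) {z w : X}
    (hw : dist z (γ.toFun 0) + δ < γ.endpointProduct w) :
    |dist z w - dist w (γ.toFun 0) - γ.busemann z| ≤ 2 * δ := by
  have hzw := γ.dist_add_busemann_le hX z w (γ.toFun 0)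
  have hw0 := γ.dist_add_busemann_le hX w (γ.toFun 0) z
  have htri := dist_triangle_left w (γ.toFun 0) z
  have hbus := γ.neg_dist_le_busemann z
  rw [γ.busemann_apply_zero] at hzw hw0
  rw [dist_comm (γ.toFun 0) z, dist_comm w z] at hw0
  unfold endpointProduct at hw
  rw [abs_le]
  constructor
  · rcases le_max_iff.1 (sub_le_iff_le_add.2 hw0) with h | h <;> linarith
  · rcases le_max_iff.1 (sub_le_iff_le_add.2 hzw) with h | h <;> linarith

theorem exists_geodesicRegion_subset {γ σ : GeodesicRay X} (h : γ.Asymptotic σ) (R : ℝ) :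
    ∃ R', geodesicRegion γ R ⊆ geodesicRegion σ R' := by
  obtain ⟨K, hK⟩ := h
  refine ⟨R + K, fun z hz => ?_⟩
  obtain ⟨_, ⟨t, rfl⟩, hzt⟩ := Metric.mem_thickening_iff.1 hz
  refine Metric.mem_thickening_iff.2 ⟨σ.toFun t, ⟨t, rfl⟩, ?_⟩
  linarith [dist_triangle z (γ.toFun t) (σ.toFun t), hK t]

theorem dist_add_busemann_lt_of_mem_geodesicRegion {R : ℝ} {z : X} (hz : z ∈ geodesicRegion γ R) :
    dist z (γ.toFun 0) + γ.busemann z < 2 * R := by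
  obtain ⟨_, ⟨t, rfl⟩, hzt⟩ := Metric.mem_thickening_iff.1 hz
  have hdist := dist_triangle z (γ.toFun t) (γ.toFun 0)
  have hbus := γ.busemann_le_add_dist z (γ.toFun t)
  rw [γ.dist_apply_zero] at hdist
  rw [γ.busemann_apply] at hbus
  linarith

end GeodesicRay

section Approach

variable {X : Type*} [MetricSpace X] {δ : ℝ}

theorem ofPoint_mem_boundaryNhd_of_lt_endpointProduct (hX : IsFourPointHyperbolic X δ)
    (γ : GeodesicRay X) {z : X} {r : ℝ} (hz : r + δ < γ.endpointProduct z) :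
    ofPoint z ∈ boundaryNhd (γ.toFun 0) γ.endpoint r := by
  intro σ hσ
  obtain ⟨K, hK⟩ := GeodesicRay.asymptotic_of_endpoint_eq hσ
  filter_upwards [(γ.tendsto_gromovProduct z).eventually_const_lt hz,
    eventually_ge_atTop (Real.toNNReal (r + δ + K))] with s hzs hs
  have hσs : r + δ ≤ gromovProduct (γ.toFun 0) (γ.toFun s) (σ.toFun s) := by
    have htri := dist_triangle_left (γ.toFun s) (γ.toFun 0) (σ.toFun s)
    rw [γ.dist_apply_zero] at htri
    rw [gromovProduct, γ.dist_apply_zero, dist_comm (γ.toFun s)]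
    linarith [hK s, Real.toNNReal_le_iff_le_coe.1 hs]
  linarith [hX (γ.toFun 0) z (σ.toFun s) (γ.toFun s), le_min hzs.le hσs]

theorem approach_eq_comap_endpointProduct (hgeo : IsGeodesicSpace X) (hhyp : IsGromovHyperbolic X)
    (γ : GeodesicRay X) : approach γ.endpoint = comap γ.endpointProduct atTop := by
  rw [approach, nhds_eq_gromovNhds hgeo hhyp]
  obtain ⟨δ, -, hδ⟩ := hhyp
  refine ((hasBasis_gromovNhds (γ.toFun 0) γ.endpoint).comap ofPoint).ext
    (atTop_basis_Ioi.comap _) (fun r _ => ?_) fun r _ => ?_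
  · exact ⟨r + 3 * δ, trivial, fun z hz =>
      ofPoint_mem_boundaryNhd_of_lt_endpointProduct (hδ.isFourPointHyperbolic hgeo) γ hz⟩
  · refine ⟨r + 1, trivial, fun z hz => ?_⟩
    exact (lt_add_one r).trans_le (ge_of_tendsto (γ.tendsto_gromovProduct z) (hz γ rfl))

theorem tendsto_approach_iff (hgeo : IsGeodesicSpace X) (hhyp : IsGromovHyperbolic X)
    (γ : GeodesicRay X) {ι : Type*} {l : Filter ι} {u : ι → X} :
    Tendsto u l (approach γ.endpoint) ↔ Tendsto (fun i => γ.endpointProduct (u i)) l atTop := by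
  rw [approach_eq_comap_endpointProduct hgeo hhyp, tendsto_comap_iff, Function.comp_def]

theorem tendsto_geodesicRay_approach (hgeo : IsGeodesicSpace X) (hhyp : IsGromovHyperbolic X)
    (γ : GeodesicRay X) : Tendsto γ.toFun atTop (approach γ.endpoint) := by
  simp only [tendsto_approach_iff hgeo hhyp, γ.endpointProduct_apply]
  exact NNReal.tendsto_coe_atTop.2 tendsto_id

theorem IsBoundaryLimitPoint.not_bddAbove_endpointProduct (hgeo : IsGeodesicSpace X)
    (hhyp : IsGromovHyperbolic X) {γ : GeodesicRay X} {x : ℕ → X}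
    (hη : IsBoundaryLimitPoint x γ.endpoint) :
    ¬BddAbove (Set.range fun n => γ.endpointProduct (x n)) := by
  obtain ⟨φ, -, hlim⟩ := hη
  have hprod : Tendsto (fun k => γ.endpointProduct (x (φ k))) atTop atTop :=
    (tendsto_approach_iff hgeo hhyp γ).1 (tendsto_comap_iff.2 hlim)
  exact fun h => not_bddAbove_of_tendsto_atTop hprod
    (h.mono (Set.range_comp_subset_range φ fun n => γ.endpointProduct (x n)))

end Approach

section BusemannShift

variable {X : Type*} [MetricSpace X] {δ : ℝ} {γ : GeodesicRay X} {f g h : X → X}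

namespace GeodesicRay

/-- The increase of the Busemann function of `γ` when `g` is applied at `z`. -/
noncomputable def busemannShift (γ : GeodesicRay X) (g : X → X) (z : X) : ℝ :=
  γ.busemann (g z) - γ.busemann z

/-- The largest increase of the Busemann function of `γ` under `g`. For non-expanding maps it is a
coarse version of the logarithm of the dilation at the endpoint of `γ`, with the advantage of being
exactly subadditive under composition. It is meaningful only if `γ.busemannShift g` is bounded
above. -/
noncomputable def busemannDilation (γ : GeodesicRay X) (g : X → X) : ℝ :=
  ⨆ z, γ.busemannShift g z

theorem busemannShift_comp (γ : GeodesicRay X) (g h : X → X) (z : X) :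
    γ.busemannShift (g ∘ h) z = γ.busemannShift g (h z) + γ.busemannShift h z :=
  (sub_add_sub_cancel _ _ _).symm

theorem busemannShift_le_busemannDilation (hg : BddAbove (Set.range (γ.busemannShift g))) (z : X) :
    γ.busemannShift g z ≤ γ.busemannDilation g :=
  le_ciSup hg z

theorem busemannDilation_le {B : ℝ} (hB : ∀ z, γ.busemannShift g z ≤ B) :
    γ.busemannDilation g ≤ B :=
  have : Nonempty X := ⟨γ.toFun 0⟩
  ciSup_le hB

theorem neg_dist_le_busemannDilation (hg : BddAbove (Set.range (γ.busemannShift g))) :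
    -dist (g (γ.toFun 0)) (γ.toFun 0) ≤ γ.busemannDilation g := by
  have hshift := busemannShift_le_busemannDilation hg (γ.toFun 0)
  rw [busemannShift, γ.busemann_apply_zero, sub_zero] at hshift
  exact (γ.neg_dist_le_busemann _).trans hshift

theorem busemannShift_comp_le (hg : BddAbove (Set.range (γ.busemannShift g)))
    (hh : BddAbove (Set.range (γ.busemannShift h))) (z : X) :
    γ.busemannShift (g ∘ h) z ≤ γ.busemannDilation g + γ.busemannDilation h := by
  rw [busemannShift_comp]
  exact add_le_add (busemannShift_le_busemannDilation hg _) (busemannShift_le_busemannDilation hh _)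

theorem bddAbove_busemannShift_iterate (hf : BddAbove (Set.range (γ.busemannShift f))) (n : ℕ) :
    BddAbove (Set.range (γ.busemannShift f^[n])) := by
  induction n with
  | zero => exact ⟨0, by simp [busemannShift, mem_upperBounds]⟩
  | succ n ih => exact ⟨_, Set.forall_mem_range.2 (busemannShift_comp_le ih hf)⟩

theorem subadditive_busemannDilation_iterate (hf : BddAbove (Set.range (γ.busemannShift f))) :
    Subadditive fun n => γ.busemannDilation f^[n] := fun m n => by
  simp only [Function.iterate_add]
  exact busemannDilation_le (busemannShift_comp_le (bddAbove_busemannShift_iterate hf m)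
    (bddAbove_busemannShift_iterate hf n))

/-- Julia's lemma: for a single `w` close enough to the endpoint, compare both sides of
`dist (g z) (g w) ≤ dist z w` with the Busemann function. -/
theorem busemannShift_le (hX : IsFourPointHyperbolic X δ) (hg : LipschitzWith 1 g) {A : ℝ}
    (hA : ∀ R, ∃ w, R < γ.endpointProduct w ∧ R < γ.endpointProduct (g w) ∧
      dist w (γ.toFun 0) - dist (g w) (γ.toFun 0) ≤ A) (z : X) :
    γ.busemannShift g z ≤ A + 4 * δ := by
  obtain ⟨w, hw, hgw, hwA⟩ := hA (max (dist z (γ.toFun 0)) (dist (g z) (γ.toFun 0)) + δ)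
  have hz := γ.abs_dist_sub_dist_sub_busemann_le hX (z := z)
    ((add_le_add_left (le_max_left _ _) δ).trans_lt hw)
  have hgz := γ.abs_dist_sub_dist_sub_busemann_le hX (z := g z)
    ((add_le_add_left (le_max_right _ _) δ).trans_lt hgw)
  have hdist := hg.dist_le_mul z w
  rw [NNReal.coe_one, one_mul] at hdist
  rw [busemannShift]
  linarith [(abs_le.1 hz).2, (abs_le.1 hgz).1]

end GeodesicRay

open GeodesicRay

theorem logDilation_le_busemannDilation_add (hgeo : IsGeodesicSpace X)
    (hhyp : IsGromovHyperbolic X) (hg : BddAbove (Set.range (γ.busemannShift g))) (p : X) :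
    logDilation g γ.endpoint p ≤
      ((γ.busemannDilation g + 2 * dist (γ.toFun 0) p : ℝ) : EReal) := by
  refine liminf_le_of_frequently_le' ((tendsto_geodesicRay_approach hgeo hhyp γ).frequently
    (Frequently.of_forall fun t => EReal.coe_le_coe_iff.2 ?_))
  have hsource := dist_triangle (γ.toFun t) (γ.toFun 0) p
  have himage := dist_triangle_right (g (γ.toFun t)) (γ.toFun 0) p
  have hshift := busemannShift_le_busemannDilation hg (γ.toFun t)
  rw [γ.dist_apply_zero] at hsource
  rw [busemannShift, γ.busemann_apply] at hshift
  linarith [γ.neg_dist_le_busemann (g (γ.toFun t))]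

theorem busemannDilation_sub_le_logDilation (hgeo : IsGeodesicSpace X)
    (hhyp : IsGromovHyperbolic X) (hX : IsFourPointHyperbolic X δ) (hLip : LipschitzWith 1 g)
    (hg : BddAbove (Set.range (γ.busemannShift g))) (p : X) :
    ((γ.busemannDilation g - (4 * δ + 2 * dist (γ.toFun 0) p) : ℝ) : EReal) ≤
      logDilation g γ.endpoint p := by
  refine EReal.le_of_forall_lt_iff_le.1 fun A hA => EReal.coe_le_coe_iff.2 ?_
  have hfreq : ∃ᶠ w in approach γ.endpoint, dist w p - dist (g w) p < A :=
    (frequently_lt_of_liminf_lt (h := hA)).mono fun w => EReal.coe_lt_coe_iff.1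
  have hprod : Tendsto γ.endpointProduct (approach γ.endpoint) atTop :=
    (tendsto_approach_iff hgeo hhyp γ).1 tendsto_id
  set D := dist (γ.toFun 0) p
  suffices hw : ∀ R, ∃ w, R < γ.endpointProduct w ∧ R < γ.endpointProduct (g w) ∧
      dist w (γ.toFun 0) - dist (g w) (γ.toFun 0) ≤ A + 2 * D by
    linarith [busemannDilation_le (busemannShift_le hX hLip hw)]
  intro R
  obtain ⟨w, hw, hRw⟩ := (hfreq.and_eventually
    (hprod.eventually_gt_atTop (max R (R + (A + 2 * D + γ.busemannDilation g) / 2)))).exists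
  obtain ⟨hR, hR'⟩ := max_lt_iff.1 hRw
  have hdist : dist w (γ.toFun 0) - dist (g w) (γ.toFun 0) ≤ A + 2 * D := by
    linarith [dist_triangle_right w (γ.toFun 0) p, dist_triangle (g w) (γ.toFun 0) p]
  refine ⟨w, hR, ?_, hdist⟩
  have hshift := busemannShift_le_busemannDilation hg w
  unfold busemannShift at hshift
  unfold endpointProduct at hR' ⊢
  linarith

theorem hasGeodesicLimit_of_bddAbove_busemannShift (hgeo : IsGeodesicSpace X)
    (hhyp : IsGromovHyperbolic X) (hg : BddAbove (Set.range (γ.busemannShift g))) :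
    HasGeodesicLimit (fun z => ofPoint (g z)) γ.endpoint (ofBoundary γ.endpoint) := by
  rintro u hu ⟨σ, R, hσ, -, hmem⟩
  obtain ⟨R', hR'⟩ := exists_geodesicRegion_subset (asymptotic_of_endpoint_eq hσ) R
  have hprod := (tendsto_approach_iff hgeo hhyp γ).1 (tendsto_comap_iff.2 hu)
  suffices hgu : Tendsto (fun n => g (u n)) atTop (approach γ.endpoint) from
    tendsto_comap_iff.1 hgu
  refine (tendsto_approach_iff hgeo hhyp γ).2 (tendsto_atTop_mono (fun n => ?_)
    (tendsto_atTop_add_const_right _ (-(R' + γ.busemannDilation g)) hprod))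
  have hregion := γ.dist_add_busemann_lt_of_mem_geodesicRegion (hR' (hmem n))
  have hshift := busemannShift_le_busemannDilation hg (u n)
  have hbus := γ.neg_dist_le_busemann (g (u n))
  unfold busemannShift at hshift
  unfold endpointProduct
  linarith

theorem isBRFP_of_bddAbove_busemannShift (hgeo : IsGeodesicSpace X) (hhyp : IsGromovHyperbolic X)
    (hg : BddAbove (Set.range (γ.busemannShift g))) : IsBRFP g γ.endpoint :=
  ⟨fun p => (logDilation_le_busemannDilation_add hgeo hhyp hg p).trans_lt (EReal.coe_lt_top _),
    hasGeodesicLimit_of_bddAbove_busemannShift hgeo hhyp hg⟩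

end BusemannShift

section BoundedStep

theorem dist_add_le_mul_of_dist_succ_le {α : Type*} [PseudoMetricSpace α] {x : ℕ → α} {K : ℝ}
    (hK : ∀ n, dist (x (n + 1)) (x n) ≤ K) (m n : ℕ) : dist (x (n + m)) (x n) ≤ m * K := by
  rw [dist_comm]
  refine (dist_le_Ico_sum_of_dist_le (d := fun _ => K) (n.le_add_right m) fun _ _ => ?_).trans ?_
  · rw [dist_comm]
    exact hK _
  · simp

theorem lipschitzWith_one_iterate {α : Type*} [PseudoEMetricSpace α] {f : α → α}
    (hf : LipschitzWith 1 f) (n : ℕ) : LipschitzWith 1 f^[n] := by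
  simpa only [one_pow] using hf.iterate n

theorem dist_iterate_le_mul {α : Type*} [PseudoMetricSpace α] {f : α → α} (hf : LipschitzWith 1 f)
    (p : α) (n : ℕ) : dist (f^[n] p) p ≤ n * dist (f p) p := by
  have hstep (k : ℕ) : dist (f^[k + 1] p) (f^[k] p) ≤ dist (f p) p := by
    simpa [dist_comm] using hf.dist_iterate_succ_le_geometric p k
  simpa using dist_add_le_mul_of_dist_succ_le (x := fun k => f^[k] p) hstep n 0

variable {X : Type*} [MetricSpace X] {f : X → X} {x : ℕ → X}

/-- The number `σ_m` of a sequence of bounded step. It is encoded as a supremum over `n`, which for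
backward orbits of non-expanding maps equals the limit as `n → ∞`, by monotonicity. -/
noncomputable def backwardStep (x : ℕ → X) (m : ℕ) : ℝ :=
  ⨆ n, dist (x (n + m)) (x n)

namespace HasBoundedStep

theorem bddAbove_dist_add (hx : HasBoundedStep x) (m : ℕ) :
    BddAbove (Set.range fun n => dist (x (n + m)) (x n)) := by
  obtain ⟨K, hK⟩ := hx
  exact ⟨m * K, Set.forall_mem_range.2 (dist_add_le_mul_of_dist_succ_le hK m)⟩

theorem dist_add_le_backwardStep (hx : HasBoundedStep x) (m n : ℕ) :
    dist (x (n + m)) (x n) ≤ backwardStep x m :=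
  le_ciSup (hx.bddAbove_dist_add m) n

theorem subadditive_backwardStep (hx : HasBoundedStep x) : Subadditive (backwardStep x) :=
  fun m k => ciSup_le fun n => calc
    dist (x (n + (m + k))) (x n) ≤ dist (x (n + m + k)) (x (n + m)) + dist (x (n + m)) (x n) := by
      rw [← add_assoc]
      exact dist_triangle _ _ _
    _ ≤ backwardStep x k + backwardStep x m :=
      add_le_add (hx.dist_add_le_backwardStep k _) (hx.dist_add_le_backwardStep m n)
    _ = backwardStep x m + backwardStep x k := add_comm _ _

theorem exists_tendsto_backwardStep_div (hx : HasBoundedStep x) :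
    ∃ b, Tendsto (fun m : ℕ => backwardStep x m / m) atTop (𝓝 b) :=
  ⟨_, hx.subadditive_backwardStep.tendsto_lim ⟨0, Set.forall_mem_range.2 fun m =>
    div_nonneg (dist_nonneg.trans (hx.dist_add_le_backwardStep m 0)) m.cast_nonneg⟩⟩

end HasBoundedStep

namespace IsBackwardOrbit

theorem iterate_apply {α : Type*} {f : α → α} {x : ℕ → α} (hx : IsBackwardOrbit f x) (m n : ℕ) :
    f^[m] (x (n + m)) = x n := by
  induction m with
  | zero => rfl
  | succ m ih => rw [Function.iterate_succ_apply, ← add_assoc, hx, ih]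

theorem monotone_dist_add (hx : IsBackwardOrbit f x) (hf : LipschitzWith 1 f) (m : ℕ) :
    Monotone fun n => dist (x (n + m)) (x n) :=
  monotone_nat_of_le_succ fun n => by
    simpa [add_right_comm n 1 m, hx (n + m), hx n] using hf.dist_le_mul (x (n + 1 + m)) (x (n + 1))

theorem tendsto_dist_add (hx : IsBackwardOrbit f x) (hf : LipschitzWith 1 f)
    (hstep : HasBoundedStep x) (m : ℕ) :
    Tendsto (fun n => dist (x (n + m)) (x n)) atTop (𝓝 (backwardStep x m)) :=
  tendsto_atTop_ciSup (hx.monotone_dist_add hf m) (hstep.bddAbove_dist_add m)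

end IsBackwardOrbit

end BoundedStep

section StableDilation

open GeodesicRay

variable {X : Type*} [MetricSpace X] {δ : ℝ} {γ : GeodesicRay X} {f : X → X} {x : ℕ → X}

theorem exists_tendsto_busemannDilation_iterate_div (hLip : LipschitzWith 1 f)
    (hf : BddAbove (Set.range (γ.busemannShift f))) :
    ∃ L, Tendsto (fun n : ℕ => γ.busemannDilation f^[n] / n) atTop (𝓝 L) := by
  refine ⟨_, (subadditive_busemannDilation_iterate hf).tendsto_lim
    ⟨-dist (f (γ.toFun 0)) (γ.toFun 0), Set.forall_mem_range.2 fun n => ?_⟩⟩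
  rcases n.eq_zero_or_pos with rfl | hn
  · simp
  · rw [le_div_iff₀ (Nat.cast_pos.2 hn)]
    linarith [neg_dist_le_busemannDilation (bddAbove_busemannShift_iterate hf n),
      dist_iterate_le_mul hLip (γ.toFun 0) n]

theorem hasLogStableDilation_of_tendsto (hgeo : IsGeodesicSpace X) (hhyp : IsGromovHyperbolic X)
    (hLip : LipschitzWith 1 f) (hf : BddAbove (Set.range (γ.busemannShift f))) {L : ℝ}
    (hL : Tendsto (fun n : ℕ => γ.busemannDilation f^[n] / n) atTop (𝓝 L)) :
    HasLogStableDilation f γ.endpoint L := by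
  have ⟨δ, _, hδ⟩ := hhyp
  intro p
  have hlim (c : ℝ) :
      Tendsto (fun n : ℕ => ((γ.busemannDilation f^[n] + c : ℝ) : EReal) / (n : EReal)) atTop
        (𝓝 (L : EReal)) := by
    have hreal : Tendsto (fun n : ℕ => (γ.busemannDilation f^[n] + c) / n) atTop (𝓝 L) := by
      simpa [add_div] using hL.add (tendsto_const_div_atTop_nhds_zero_nat c)
    exact ((continuous_coe_real_ereal.tendsto L).comp hreal).congr fun n => EReal.coe_div _ _
  refine tendsto_of_tendsto_of_tendsto_of_le_of_le
    (hlim (-(4 * (3 * δ) + 2 * dist (γ.toFun 0) p))) (hlim (2 * dist (γ.toFun 0) p))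
    (fun n => EReal.div_le_div_right_of_nonneg n.cast_nonneg' ?_)
    fun n => EReal.div_le_div_right_of_nonneg n.cast_nonneg' ?_
  · exact busemannDilation_sub_le_logDilation hgeo hhyp (hδ.isFourPointHyperbolic hgeo)
      (lipschitzWith_one_iterate hLip n) (bddAbove_busemannShift_iterate hf n) p
  · exact logDilation_le_busemannDilation_add hgeo hhyp (bddAbove_busemannShift_iterate hf n) p

theorem IsBackwardOrbit.busemannShift_iterate_le (hX : IsFourPointHyperbolic X δ)
    (hLip : LipschitzWith 1 f) (hx : IsBackwardOrbit f x)
    (hη : ¬BddAbove (Set.range fun n => γ.endpointProduct (x n))) {m : ℕ} {A : ℝ}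
    (hA : ∀ n, dist (x (n + m)) (x n) ≤ A) (z : X) :
    γ.busemannShift f^[m] z ≤ A + 4 * δ := by
  refine busemannShift_le hX (lipschitzWith_one_iterate hLip m) (fun R => ?_) z
  obtain ⟨_, ⟨n, rfl⟩, hn⟩ := not_bddAbove_iff.1 hη (R + A)
  have hA0 : 0 ≤ A := dist_nonneg.trans (hA n)
  have hprod := γ.endpointProduct_le_add_dist (x n) (x (n + m))
  rw [dist_comm] at hprod
  refine ⟨x (n + m), by linarith [hA n], ?_, ?_⟩ <;> rw [hx.iterate_apply]
  · linarith
  · linarith [dist_triangle (x (n + m)) (x n) (γ.toFun 0), hA n]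

theorem dist_add_busemann_sub_busemann_le (hX : IsFourPointHyperbolic X δ) {y : ℕ → X} {M : ℝ}
    (hM : ∀ n, dist (y (n + 1)) (y n) ≤ M)
    (hy : ∀ n, γ.busemann (y n) + 2 * δ ≤ γ.busemann (y (n + 1))) (k j : ℕ) :
    dist (y j) (y (j + k)) + γ.busemann (y j) - γ.busemann (y (j + k)) ≤ M := by
  have : Nonempty X := ⟨y 0⟩
  have hδ := hX.nonneg
  induction k generalizing j with
  | zero => simpa using dist_nonneg.trans (hM 0)
  | succ k ih =>
    -- The gain `2 * δ` in `hy` absorbs the error of the four-point inequality, so the bound `M`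
    -- does not deteriorate along the induction.
    have hih := ih (j + 1)
    rw [add_right_comm j 1 k, add_assoc, dist_comm] at hih
    have hfour := γ.dist_add_busemann_le hX (y j) (y (j + (k + 1))) (y (j + 1))
    have hMj := hM j
    rw [dist_comm] at hMj
    rcases le_max_iff.1 (sub_le_iff_le_add.2 hfour) with h | h <;> linarith [hy j]

theorem bddAbove_endpointProduct_of_busemann_add_le (hX : IsFourPointHyperbolic X δ)
    (hstep : HasBoundedStep x) {N : ℕ} (hN : 0 < N)
    (hbus : ∀ n, γ.busemann (x n) + 2 * δ ≤ γ.busemann (x (n + N))) :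
    BddAbove (Set.range fun n => γ.endpointProduct (x n)) := by
  obtain ⟨K, hK⟩ := hstep
  have hK0 : 0 ≤ K := dist_nonneg.trans (hK 0)
  have hsub (k : ℕ) :
      dist (x 0) (x (N * k)) + γ.busemann (x 0) - γ.busemann (x (N * k)) ≤ N * K := by
    simpa using dist_add_busemann_sub_busemann_le hX (y := fun j => x (N * j)) (M := N * K)
      (fun j => dist_add_le_mul_of_dist_succ_le hK N (N * j)) (fun j => hbus (N * j)) k 0
  refine ⟨(N * K + dist (x 0) (γ.toFun 0) - γ.busemann (x 0)) / 2 + N * K,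
    Set.forall_mem_range.2 fun n => ?_⟩
  have hnear : dist (x n) (x (N * (n / N))) ≤ N * K := calc
    dist (x n) (x (N * (n / N))) ≤ (n % N : ℕ) * K := by
      simpa only [Nat.div_add_mod] using
        dist_add_le_mul_of_dist_succ_le hK (n % N) (N * (n / N))
    _ ≤ N * K := by gcongr; exact (n.mod_lt hN).le
  have hmultiple : γ.endpointProduct (x (N * (n / N))) ≤
      (N * K + dist (x 0) (γ.toFun 0) - γ.busemann (x 0)) / 2 := by
    rw [endpointProduct]
    linarith [hsub (n / N), dist_triangle_left (x (N * (n / N))) (γ.toFun 0) (x 0)]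
  linarith [γ.endpointProduct_le_add_dist (x n) (x (N * (n / N)))]

theorem IsBackwardOrbit.nonneg_of_tendsto_busemannDilation (hX : IsFourPointHyperbolic X δ)
    (hx : IsBackwardOrbit f x) (hstep : HasBoundedStep x)
    (hη : ¬BddAbove (Set.range fun n => γ.endpointProduct (x n)))
    (hf : BddAbove (Set.range (γ.busemannShift f))) {L : ℝ}
    (hL : Tendsto (fun n : ℕ => γ.busemannDilation f^[n] / n) atTop (𝓝 L)) : 0 ≤ L := by
  by_contra! hneg
  obtain ⟨N, hN, hN0⟩ : ∃ N : ℕ, γ.busemannDilation f^[N] / N * N ≤ -(2 * δ) ∧ 0 < N :=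
    (((hL.neg_mul_atTop hneg tendsto_natCast_atTop_atTop).eventually_le_atBot (-(2 * δ))).and
      (eventually_gt_atTop 0)).exists
  rw [div_mul_cancel₀ _ (Nat.cast_ne_zero.2 hN0.ne')] at hN
  refine hη (bddAbove_endpointProduct_of_busemann_add_le hX hstep hN0 fun n => ?_)
  have hshift := busemannShift_le_busemannDilation (bddAbove_busemannShift_iterate hf N) (x (n + N))
  rw [busemannShift, hx.iterate_apply] at hshift
  linarith

end StableDilation

end GromovDynamics

open GromovDynamics in
theorem mainTheorem12_general {X : Type*} [MetricSpace X]
    (hgeo : IsGeodesicSpace X) (hhyp : IsGromovHyperbolic X)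
    (f : X → X) (hf : LipschitzWith 1 f)
    (x : ℕ → X) (hx : IsBackwardOrbit f x) (hstep : HasBoundedStep x)
    (η : GromovBoundary X) (hη : IsBoundaryLimitPoint x η) :
    IsBRFP f η ∧ ∃ L b : ℝ, HasLogStableDilation f η L ∧ HasBackwardStepRate x b ∧
      0 ≤ L ∧ L ≤ b := by
  have ⟨δ, _, hδ⟩ := hhyp
  have hX := hδ.isFourPointHyperbolic hgeo
  obtain ⟨γ, rfl⟩ := GeodesicRay.exists_endpoint_eq η
  have hunbdd := hη.not_bddAbove_endpointProduct hgeo hhyp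
  have hshift (n : ℕ) (z : X) : γ.busemannShift f^[n] z ≤ backwardStep x n + 4 * (3 * δ) :=
    hx.busemannShift_iterate_le hX hf hunbdd (hstep.dist_add_le_backwardStep n) z
  have hbdd : BddAbove (Set.range (γ.busemannShift f)) :=
    ⟨_, Set.forall_mem_range.2 (hshift 1)⟩
  obtain ⟨L, hL⟩ := exists_tendsto_busemannDilation_iterate_div hf hbdd
  obtain ⟨b, hb⟩ := hstep.exists_tendsto_backwardStep_div
  refine ⟨isBRFP_of_bddAbove_busemannShift hgeo hhyp hbdd, L, b,
    hasLogStableDilation_of_tendsto hgeo hhyp hf hbdd hL,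
    ⟨backwardStep x, fun m _ => hx.tendsto_dist_add hf hstep m, hb⟩,
    hx.nonneg_of_tendsto_busemannDilation hX hstep hunbdd hbdd hL, ?_⟩
  have hb' := hb.add (tendsto_const_div_atTop_nhds_zero_nat (4 * (3 * δ)))
  rw [add_zero] at hb'
  refine le_of_tendsto_of_tendsto' hL hb' fun n => ?_
  rw [← add_div]
  exact div_le_div_of_nonneg_right (GeodesicRay.busemannDilation_le (hshift n)) n.cast_nonneg

theorem mainTheorem12 {X : Type*} [MetricSpace X] [ProperSpace X]
    (hgeo : GromovDynamics.IsGeodesicSpace X) (hhyp : GromovDynamics.IsGromovHyperbolic X)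
    (f : X → X) (hf : LipschitzWith 1 f)
    (x : ℕ → X) (hx : GromovDynamics.IsBackwardOrbit f x) (hstep : GromovDynamics.HasBoundedStep x)
    (η : GromovDynamics.GromovBoundary X) (hη : GromovDynamics.IsBoundaryLimitPoint x η) :
    GromovDynamics.IsBRFP f η ∧
      ∃ L b : ℝ, GromovDynamics.HasLogStableDilation f η L ∧
        GromovDynamics.HasBackwardStepRate x b ∧ 0 ≤ L ∧ L ≤ b :=
  mainTheorem12_general hgeo hhyp f hf x hx hstep η hη
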